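/- For an odd integer $q\ge 3$ let $W$ be the typewriter channel on $\mathbb{Z}_q$ with crossover probability $1/2$: input $x$ is received as $x$ or $x+1$, each with probability $1/2$. Logarithms are to base $2$. Let $$E(R)=\limsup_{n\to\infty}\frac1n\log\frac1{\mathsf P_{\mathrm e}(\lceil 2^{nR}\rceil,n)}\in[0,+\infty]$$ be its reliability function, where $\mathsf P_{\mathrm e}(M,n)$ is the smallest probability of error (average or maximal over the codewords; the statement holds for both) of codes with $M$ codewords of length $n$, over all possibly randomized decoders, used on the $n$-fold memoryless extension of $W$. For real $Q>1$ put $$H_Q(t)=t\log(Q-1)-t\log t-(1-t)\log(1-t),\qquad R_{\mathrm{LP1}}(Q,\delta)=H_Q\!\left(\frac{(Q-1)-(Q-2)\delta-2\sqrt{(Q-1)\delta(1-\delta)}}{Q}\right),$$ with $0\log 0=0$. **Theorem.** Let $q=5$. The map $E\mapsto \log\sqrt5+R_{\mathrm{LP1}}(\sqrt5,E)$ is a bijection from $[0,1-1/\sqrt5]$ onto $[\log\sqrt5,\log 5]$; let $E_{\mathrm{LP1}}$ be its inverse. Then $E(R)\le E_{\mathrm{LP1}}(R)$ for all $\log\sqrt5<R<\log(5/2)$.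 More generally, for every odd $q\ge3$ put $q'=1+\frac1{\cos(\pi/q)}$ and $r_q=\log\frac{q\cos(\pi/q)}{1+\cos(\pi/q)}$. The map $E\mapsto r_q+R_{\mathrm{LP1}}(q',E)$ is a bijection from $[0,1-1/q']$ onto $[r_q,\log q]$, and $E(R)$ is at most the value at $R$ of its inverse, for all $r_q<R<\log(q/2)$. -/

import Mathlib

open Set Filter

namespace Typewriter

noncomputable section

/-- Transition probability `W(y | x)` of the typewriter channel on `ZMod q` with crossover
probability `1/2`: the input `x` is received as `x` or as `x + 1`, each with probability `1/2`. -/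
def W {q : ℕ} (y x : ZMod q) : ℝ := if y = x ∨ y = x + 1 then 1 / 2 else 0

/-- The `n`-fold memoryless extension of the channel. -/
def Wn {q n : ℕ} (y x : Fin n → ZMod q) : ℝ := ∏ k, W (y k) (x k)

/-- A code with `M` codewords of length `n`, together with a (possibly randomized) decoder:
`dec y m` is the probability that message `m` is decided when `y` is received. -/
structure Code (q n M : ℕ) where
  enc : Fin M → Fin n → ZMod q
  dec : (Fin n → ZMod q) → Fin M → ℝ
  dec_nonneg : ∀ y m, 0 ≤ dec y m
  dec_sum : ∀ y, ∑ m, dec y m = 1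

/-- Probability of a decoding error when message `m` is sent. -/
def Code.err {q n M : ℕ} [NeZero q] (c : Code q n M) (m : Fin M) : ℝ :=
  ∑ y : Fin n → ZMod q, Wn y (c.enc m) * (1 - c.dec y m)

/-- Average probability of error over the codewords. -/
def Code.avgErr {q n M : ℕ} [NeZero q] (c : Code q n M) : ℝ := (∑ m, c.err m) / M

/-- Maximal probability of error over the codewords. -/
def Code.maxErr {q n M : ℕ} [NeZero q] (c : Code q n M) : ℝ := ⨆ m, c.err m

/-- Smallest average probability of error of codes with `M` codewords of length `n`. -/
def PeAvg (q : ℕ) [NeZero q] (M n : ℕ) : ℝ := ⨅ c : Code q n M, c.avgErr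

/-- Smallest maximal probability of error of codes with `M` codewords of length `n`. -/
def PeMax (q : ℕ) [NeZero q] (M n : ℕ) : ℝ := ⨅ c : Code q n M, c.maxErr

/-- `(1/n) log₂ (1/p)`, equal to `+∞` when `p = 0`. -/
def errExponent (p : ℝ) (n : ℕ) : EReal :=
  if p = 0 then ⊤ else (((1 / (n : ℝ)) * Real.logb 2 (1 / p) : ℝ) : EReal)

/-- `limsup_n (1/n) log₂ (1 / Pe(⌈2^{nR}⌉, n))`. -/
def reliability (Pe : ℕ → ℕ → ℝ) (R : ℝ) : EReal :=
  limsup (fun n : ℕ => errExponent (Pe ⌈(2 : ℝ) ^ ((n : ℝ) * R)⌉₊ n) n) atTop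

/-- The reliability function of the `q`-input channel, for the average probability of error. -/
def EAvg (q : ℕ) [NeZero q] (R : ℝ) : EReal := reliability (PeAvg q) R

/-- The reliability function of the `q`-input channel, for the maximal probability of error. -/
def EMax (q : ℕ) [NeZero q] (R : ℝ) : EReal := reliability (PeMax q) R

/-- The `Q`-ary entropy function (in bits), for a real parameter `Q`. -/
def entropy (Q t : ℝ) : ℝ :=
  t * Real.logb 2 (Q - 1) - t * Real.logb 2 t - (1 - t) * Real.logb 2 (1 - t)

/-- The first linear programming bound, for a real alphabet size `Q`. -/
def RLP1 (Q δ : ℝ) : ℝ :=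
  entropy Q (((Q - 1) - (Q - 2) * δ - 2 * √((Q - 1) * δ * (1 - δ))) / Q)

/-- The map `E ↦ r₀ + R_LP1(Q, E)`. -/
def rateLP1 (r₀ Q E : ℝ) : ℝ := r₀ + RLP1 Q E

/-- The inverse function of `E ↦ r₀ + R_LP1(Q, E)` on `0 ≤ E ≤ 1 - 1 / Q`. -/
def ELP1 (r₀ Q R : ℝ) : ℝ :=
  Function.invFunOn (rateLP1 r₀ Q) (Icc 0 (1 - 1 / Q)) R

/-- The Lovász bound (in bits) for the cycle with `q` vertices, `q` odd. -/
def lovaszRate (q : ℕ) : ℝ :=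
  Real.logb 2 (q * Real.cos (Real.pi / q) / (1 + Real.cos (Real.pi / q)))

/-- The non-integer alphabet size `1 + 1 / cos (π / q)`. -/
def altSize (q : ℕ) : ℝ := 1 + 1 / Real.cos (Real.pi / q)

end

end Typewriter

/-!
Two codewords that the channel can confuse and that differ in `d` coordinates have a common output
of probability `2 ^ (-d)`, so the error exponent is governed by the least distance `δ n` of a
confusable pair. To bound the size of a code without close confusable pairs, put `C = cos (π / q)`
and consider the kernel `K (c i - c j)`, where `K` is the product of the functions
`1_{0} + (1_{1} + 1_{-1}) / (2 C)`: it vanishes on pairs that cannot be confused, is positive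
definite because no `cos (2 π j / q)` is less than `-C`, and stays so when multiplied by two
Krawtchouk polynomials for the non-integer alphabet size `1 + 1 / C`. Testing `K` against
`(P - λ) φ ^ 2`, where `P` is the sum of the polynomials of degree one, `λ` is its value at distance
`δ n`, and `φ` is an approximate eigenvector of multiplication by `P` among the polynomials of
degree at most `τ n`, gives the linear programming bound with a Hamming ball of radius `τ n`.
-/

namespace Typewriter

open scoped Topology Real

section PositiveDefinite

variable {ι κ G Ω : Type*} [Fintype ι] [Fintype κ] [AddCommGroup G] [Finite G]
  [Fintype Ω] {ψ : Ω → AddChar G ℂ} {w : κ → Ω → ℝ} {K : κ → G → ℝ}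

theorem sum_sum_prod_sub_eq_sum_normSq [DecidableEq κ]
    (hK : ∀ k z, (K k z : ℂ) = ∑ ω, w k ω * ψ ω z) (c : ι → κ → G) :
    ∑ i, ∑ j, ∏ k, K k (c i k - c j k)
      = ∑ ω : κ → Ω, (∏ k, w k (ω k)) * Complex.normSq (∑ i, ∏ k, ψ (ω k) (c i k)) := by
  have expand (i j : ι) : (∏ k, K k (c i k - c j k) : ℂ)
      = ∑ ω : κ → Ω, (∏ k, (w k (ω k) : ℂ))
        * ((∏ k, ψ (ω k) (c i k)) * starRingEnd ℂ (∏ k, ψ (ω k) (c j k))) := by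
    simp_rw [hK, Finset.prod_univ_sum, Fintype.piFinset_univ, map_prod, ← Finset.prod_mul_distrib,
      ← AddChar.map_neg_eq_conj, ← AddChar.map_add_eq_mul, sub_eq_add_neg]
  rw [← Complex.ofReal_inj]
  push_cast
  simp_rw [expand, ← Complex.mul_conj, map_sum, Finset.sum_mul_sum, Finset.mul_sum]
  rw [Finset.sum_congr rfl fun i _ => Finset.sum_comm, Finset.sum_comm]

theorem prod_mul_card_sq_le_sum_sum_prod_sub (hK : ∀ k z, (K k z : ℂ) = ∑ ω, w k ω * ψ ω z)
    (hw : ∀ k ω, 0 ≤ w k ω) {ω₀ : Ω} (hψ : ψ ω₀ = 1) (c : ι → κ → G) :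
    (∏ k, w k ω₀) * (Fintype.card ι : ℝ) ^ 2 ≤ ∑ i, ∑ j, ∏ k, K k (c i k - c j k) := by
  classical
  rw [sum_sum_prod_sub_eq_sum_normSq hK]
  have term_le := Finset.single_le_sum
    (f := fun ω : κ → Ω => (∏ k, w k (ω k)) * Complex.normSq (∑ i, ∏ k, ψ (ω k) (c i k)))
    (fun ω _ => mul_nonneg (Finset.prod_nonneg fun k _ => hw k _) (Complex.normSq_nonneg _))
    (Finset.mem_univ fun _ => ω₀)
  simpa [hψ, Complex.normSq_natCast, sq] using term_le

end PositiveDefinite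

section StepKernel

variable {q : ℕ}

/-- The function `1_{0} + a (1_{1} + 1_{-1})` on `ZMod q`. Its products over the coordinates serve
as kernels that vanish on pairs of words that the channel cannot confuse. -/
noncomputable def stepKernel (a : ℝ) (z : ZMod q) : ℝ :=
  (if z = 0 then 1 else 0) + a * ((if z = 1 then 1 else 0) + if z = -1 then 1 else 0)

/-- The Fourier coefficient of `stepKernel a` at the character `z ↦ exp (2 π i ω z / q)`. -/
noncomputable def stepWeight (a : ℝ) (ω : ZMod q) : ℝ :=
  (1 + a * (2 * Real.cos (2 * π * ω.val / q))) / q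

theorem stepWeight_zero (a : ℝ) : stepWeight a (0 : ZMod q) = (1 + 2 * a) / q := by
  simp [stepWeight, mul_comm]

theorem stepKernel_nonneg {a : ℝ} (ha : 0 ≤ a) (z : ZMod q) : 0 ≤ stepKernel a z := by
  unfold stepKernel
  positivity

theorem stepKernel_zero [Nontrivial (ZMod q)] (a : ℝ) : stepKernel a (0 : ZMod q) = 1 := by
  simp [stepKernel]

theorem two_mul_cos_eq_stdAddChar_add [NeZero q] (ω : ZMod q) :
    (2 * Real.cos (2 * π * ω.val / q) : ℂ) = ZMod.stdAddChar ω + ZMod.stdAddChar (-ω) := by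
  rw [AddChar.map_neg_eq_inv, ZMod.stdAddChar_apply, ZMod.toCircle_apply, ← Complex.exp_neg,
    Complex.ofReal_cos, Complex.two_cos]
  push_cast
  congr 2 <;> ring

theorem sum_stdAddChar_mul [NeZero q] (z : ZMod q) :
    ∑ ω : ZMod q, ZMod.stdAddChar (N := q) (ω * z) = if z = 0 then (q : ℂ) else 0 := by
  simpa only [ZMod.card, Nat.cast_ite, Nat.cast_zero] using
    AddChar.sum_mulShift (R' := ℂ) z (ZMod.isPrimitive_stdAddChar q)

theorem stepKernel_eq_sum_stdAddChar [NeZero q] (a : ℝ) (z : ZMod q) :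
    (stepKernel a z : ℂ)
      = ∑ ω, stepWeight a ω * AddChar.mulShift (ZMod.stdAddChar (N := q)) ω z := by
  have hq : (q : ℂ) ≠ 0 := NeZero.ne _
  have term_eq (ω : ZMod q) :
      (stepWeight a ω : ℂ) * AddChar.mulShift (ZMod.stdAddChar (N := q)) ω z
        = (ZMod.stdAddChar (ω * z)
          + a * (ZMod.stdAddChar (ω * (z + 1)) + ZMod.stdAddChar (ω * (z - 1)))) / q := by
    have weight_eq : (stepWeight a ω : ℂ)
        = (1 + a * (2 * (Real.cos (2 * π * ω.val / q) : ℂ))) / q := by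
      rw [stepWeight]; push_cast; rfl
    rw [weight_eq, two_mul_cos_eq_stdAddChar_add, AddChar.mulShift_apply, mul_add ω, mul_sub,
      mul_one, sub_eq_add_neg, AddChar.map_add_eq_mul, AddChar.map_add_eq_mul]
    ring
  simp_rw [term_eq, ← Finset.sum_div, Finset.sum_add_distrib, ← Finset.mul_sum,
    Finset.sum_add_distrib, sum_stdAddChar_mul, stepKernel, add_eq_zero_iff_eq_neg, sub_eq_zero]
  field_simp
  split_ifs <;> push_cast <;> ring

theorem stepWeight_nonneg {C a : ℝ} (hcos : ∀ ω : ZMod q, -C ≤ Real.cos (2 * π * ω.val / q))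
    (ha : -(1 / 2) ≤ a) (haC : a * (2 * C) ≤ 1) (ω : ZMod q) : 0 ≤ stepWeight a ω := by
  refine div_nonneg ?_ (Nat.cast_nonneg q)
  rcases le_total 0 a with h | h
  · linarith [mul_le_mul_of_nonneg_left (hcos ω) h]
  · linarith [mul_le_mul_of_nonpos_left (Real.cos_le_one (2 * π * ω.val / q)) h]

-- `2j - q` is odd, hence `1 ≤ |2j - q| ≤ q`, and `cos (2πj/q) = -cos (π|2j - q|/q)`.
theorem neg_cos_pi_div_le_cos (hq : Odd q) {j : ℕ} (hj : j ≤ q) :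
    -Real.cos (π / q) ≤ Real.cos (2 * π * j / q) := by
  have hq_pos : (0 : ℝ) < q := by exact_mod_cast hq.pos
  have one_le : (1 : ℝ) ≤ |2 * (j : ℝ) - q| := by
    have : (1 : ℤ) ≤ |2 * (j : ℤ) - q| := Int.one_le_abs (by grind)
    exact_mod_cast this
  have le_q : |(2 : ℝ) * j - q| ≤ q := by
    have : (j : ℝ) ≤ q := by exact_mod_cast hj
    rw [abs_le]
    constructor <;> linarith [Nat.cast_nonneg (α := ℝ) j]
  have cos_eq : Real.cos (2 * π * j / q) = -Real.cos (π * |2 * (j : ℝ) - q| / q) := by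
    have arg_eq : 2 * π * j / q = π * (2 * j - q) / q + π := by field_simp; ring
    rw [arg_eq, Real.cos_add_pi, ← Real.cos_abs, abs_div, abs_mul, abs_of_pos Real.pi_pos,
      abs_of_pos hq_pos]
  rw [cos_eq]
  refine neg_le_neg (Real.cos_le_cos_of_nonneg_of_le_pi (by positivity) ?_ ?_)
  · rw [div_le_iff₀ hq_pos]
    gcongr
  · gcongr
    exact le_mul_of_one_le_right Real.pi_nonneg one_le

theorem cos_pi_div_natCast_pos (hq : 3 ≤ q) : 0 < Real.cos (π / q) := by
  have : π / q ≤ π / 3 := by gcongr; exact_mod_cast hq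
  exact Real.cos_pos_of_mem_Ioo ⟨by linarith [Real.pi_pos, show 0 ≤ π / q by positivity],
    by linarith [Real.pi_pos]⟩

end StepKernel

section Confusability

variable {q : ℕ} {ι κ : Type*} [Fintype κ]

/-- The relation that some output of the channel is possible for both inputs: the graph of the
`q`-cycle with loops. -/
def Confusable (x x' : ZMod q) : Prop := x = x' ∨ x = x' + 1 ∨ x' = x + 1

/-- The property that any two codewords which the channel can confuse in every coordinate differ in
at least `d` coordinates. -/
def HasConfusableDist (d : ℝ) (c : ι → κ → ZMod q) : Prop :=
  ∀ ⦃i j⦄, i ≠ j → (∀ k, Confusable (c i k) (c j k)) → d ≤ hammingDist (c i) (c j)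

theorem stepKernel_sub_eq_zero (a : ℝ) {x x' : ZMod q} (h : ¬Confusable x x') :
    stepKernel a (x - x') = 0 := by
  obtain ⟨h_eq, h_succ, h_pred⟩ := by simpa only [Confusable, not_or] using h
  have sub_ne_one : x - x' ≠ 1 := by rwa [Ne, sub_eq_iff_eq_add']
  have sub_ne_neg_one : x - x' ≠ -1 := by rwa [Ne, sub_eq_iff_eq_add', ← sub_eq_add_neg,
    eq_sub_iff_add_eq, eq_comm]
  simp [stepKernel, sub_eq_zero, h_eq, sub_ne_one, sub_ne_neg_one]

end Confusability

section Krawtchouk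

variable {q : ℕ} {κ : Type*}

/-- The Krawtchouk polynomial of degree one in one coordinate, for the real alphabet size
`1 + 1 / C`, normalized to take the value `1` at `0`. -/
noncomputable def krawtchouk (C : ℝ) (z : ZMod q) : ℝ := if z = 0 then 1 else -C

/-- The multivariate Krawtchouk polynomial attached to a set of coordinates. -/
noncomputable def krawtchoukProd (C : ℝ) (S : Finset κ) (z : κ → ZMod q) : ℝ :=
  ∏ k ∈ S, krawtchouk C (z k)

theorem krawtchouk_mul_self (C : ℝ) (z : ZMod q) :
    krawtchouk C z * krawtchouk C z = C + (1 - C) * krawtchouk C z := by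
  unfold krawtchouk
  split_ifs <;> ring

theorem stepKernel_mul_krawtchouk [Nontrivial (ZMod q)] (C a : ℝ) (z : ZMod q) :
    stepKernel a z * krawtchouk C z = stepKernel (a * -C) z := by
  by_cases hz : z = 0
  · simp [hz, krawtchouk, stepKernel_zero]
  · simp only [hz, stepKernel, krawtchouk, if_false]
    ring

variable [Fintype κ]

theorem sum_krawtchouk_sub (C : ℝ) (x x' : κ → ZMod q) :
    ∑ k, krawtchouk C (x k - x' k) = Fintype.card κ - (1 + C) * hammingDist x x' := by
  have krawtchouk_eq (k : κ) :
      krawtchouk C (x k - x' k) = 1 - (1 + C) * if x k ≠ x' k then 1 else 0 := by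
    by_cases h : x k = x' k <;> simp [krawtchouk, h, sub_eq_zero]
  simp_rw [krawtchouk_eq, Finset.sum_sub_distrib, ← Finset.mul_sum, Finset.sum_boole, hammingDist]
  simp

/-- The expansion `∑ S, b S * krawtchoukProd C S z` with coefficients `b`. -/
noncomputable def krawtchoukSum (C : ℝ) (b : Finset κ → ℝ) (z : κ → ZMod q) : ℝ :=
  ∑ S, b S * krawtchoukProd C S z

variable [DecidableEq κ]

/-- The three-term recurrence: the action on the coefficients of a Krawtchouk expansion of
multiplication by the sum over all coordinates of the polynomials of degree one. -/
noncomputable def recurrence (C : ℝ) (b : Finset κ → ℝ) (S : Finset κ) : ℝ :=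
  ∑ k ∈ S, (b (S.erase k) + (1 - C) * b S) + ∑ k ∈ Sᶜ, C * b (insert k S)

theorem sum_filter_mem_eq_sum_filter_notMem_insert (F : Finset κ → ℝ) (k : κ) :
    ∑ S with k ∈ S, F S = ∑ S with k ∉ S, F (insert k S) := by
  refine Finset.sum_nbij' (fun S => S.erase k) (fun S => insert k S) ?_ ?_ ?_ ?_ ?_ <;>
    simp +contextual

theorem krawtchouk_mul_krawtchoukSum (C : ℝ) (b : Finset κ → ℝ) (z : κ → ZMod q) (k : κ) :
    krawtchouk C (z k) * krawtchoukSum C b z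
      = ∑ S, (if k ∈ S then b (S.erase k) + (1 - C) * b S else C * b (insert k S))
        * krawtchoukProd C S z := by
  rw [krawtchoukSum, Finset.mul_sum, ← Finset.sum_filter_add_sum_filter_not _ (k ∈ ·),
    ← Finset.sum_filter_add_sum_filter_not _ (k ∈ ·) (fun S => (if k ∈ S then _ else _) * _),
    sum_filter_mem_eq_sum_filter_notMem_insert, sum_filter_mem_eq_sum_filter_notMem_insert,
    ← Finset.sum_add_distrib, ← Finset.sum_add_distrib]
  refine Finset.sum_congr rfl fun S hS => ?_
  replace hS : k ∉ S := by simpa using hS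
  simp only [krawtchoukProd, hS, Finset.mem_insert, true_or, if_true, if_false,
    Finset.erase_insert hS, Finset.prod_insert hS]
  linear_combination
    (b (insert k S) * ∏ i ∈ S, krawtchouk C (z i)) * krawtchouk_mul_self C (z k)

theorem sum_krawtchouk_mul_krawtchoukSum (C : ℝ) (b : Finset κ → ℝ) (z : κ → ZMod q) :
    (∑ k, krawtchouk C (z k)) * krawtchoukSum C b z = krawtchoukSum C (recurrence C b) z := by
  simp_rw [Finset.sum_mul, krawtchouk_mul_krawtchoukSum]
  rw [Finset.sum_comm]
  refine Finset.sum_congr rfl fun S _ => ?_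
  rw [← Finset.sum_mul, recurrence, ← Finset.sum_add_sum_compl S]
  congr 2
  · exact Finset.sum_congr rfl fun k hk => if_pos hk
  · exact Finset.sum_congr rfl fun k hk => if_neg (Finset.mem_compl.mp hk)

end Krawtchouk

section LinearProgram

variable {q : ℕ} {ι κ : Type*} [Fintype ι] [Fintype κ] {C d : ℝ}

/-- The product of the kernels `stepKernel (1 / (2 * C))`, supported on the pairs of words that the
channel can confuse. The parameter makes the polynomials `krawtchoukProd C S` orthogonal. -/
noncomputable def confusionKernel (C : ℝ) (z : κ → ZMod q) : ℝ :=
  ∏ k, stepKernel (1 / (2 * C)) (z k)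

theorem confusionKernel_nonneg (hC : 0 < C) (z : κ → ZMod q) : 0 ≤ confusionKernel C z :=
  Finset.prod_nonneg fun k _ => stepKernel_nonneg (by positivity) (z k)

theorem confusionKernel_sub_eq_zero {x x' : κ → ZMod q} (h : ¬∀ k, Confusable (x k) (x' k)) :
    confusionKernel C (x - x') = 0 := by
  obtain ⟨k, hk⟩ := not_forall.mp h
  exact Finset.prod_eq_zero (Finset.mem_univ k) (stepKernel_sub_eq_zero _ hk)

/-- The parameter into which multiplication by `krawtchoukProd C S` and `krawtchoukProd C T` turns
the parameter `1 / (2 * C)` of `confusionKernel C` at the coordinate `k`. -/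
noncomputable def twist [DecidableEq κ] (C : ℝ) (S T : Finset κ) (k : κ) : ℝ :=
  (1 / (2 * C) * if k ∈ S then -C else 1) * if k ∈ T then -C else 1

omit [Fintype κ] in
theorem neg_half_le_twist [DecidableEq κ] (hC : 0 < C) (S T : Finset κ) (k : κ) :
    -(1 / 2) ≤ twist C S T k := by
  have h_neg : 1 / (2 * C) * -C = -(1 / 2) := by field_simp
  have h_inv : 0 < 1 / (2 * C) := by positivity
  unfold twist
  split_ifs <;> nlinarith

omit [Fintype κ] in
theorem twist_mul_le_one [DecidableEq κ] (hC : 0 < C) (hC1 : C ≤ 1) (S T : Finset κ) (k : κ) :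
    twist C S T k * (2 * C) ≤ 1 := by
  unfold twist
  split_ifs <;> field_simp <;> nlinarith

omit [Fintype κ] in
theorem stepWeight_twist_self [DecidableEq κ] (hC : 0 < C) (S : Finset κ) (k : κ) :
    stepWeight (twist C S S k) (0 : ZMod q) = (1 + C) / (C * q) * if k ∈ S then C else 1 := by
  rw [stepWeight_zero, twist]
  split_ifs <;> field_simp
  ring

theorem confusionKernel_mul_krawtchoukProd [DecidableEq κ] [Nontrivial (ZMod q)] (C : ℝ)
    (S T : Finset κ) (z : κ → ZMod q) :
    confusionKernel C z * (krawtchoukProd C S z * krawtchoukProd C T z)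
      = ∏ k, stepKernel (twist C S T k) (z k) := by
  have prod_eq (S : Finset κ) :
      krawtchoukProd C S z = ∏ k, if k ∈ S then krawtchouk C (z k) else 1 := by
    simp [krawtchoukProd]
  rw [prod_eq, prod_eq, confusionKernel, ← Finset.prod_mul_distrib, ← Finset.prod_mul_distrib]
  refine Finset.prod_congr rfl fun k _ => ?_
  unfold twist
  split_ifs <;> simp only [mul_one, one_mul, ← stepKernel_mul_krawtchouk, ← mul_assoc]

variable [NeZero q] [Nontrivial (ZMod q)]

theorem sum_sum_confusionKernel_mul_krawtchoukProd_ge [DecidableEq κ] (hC : 0 < C) (hC1 : C ≤ 1)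
    (hcos : ∀ ω : ZMod q, -C ≤ Real.cos (2 * π * ω.val / q)) (c : ι → κ → ZMod q)
    (S T : Finset κ) :
    (if S = T then ((1 + C) / (C * q)) ^ Fintype.card κ * C ^ S.card else 0)
        * (Fintype.card ι : ℝ) ^ 2
      ≤ ∑ i, ∑ j, confusionKernel C (c i - c j)
        * (krawtchoukProd C S (c i - c j) * krawtchoukProd C T (c i - c j)) := by
  have weight_nonneg (k : κ) (ω : ZMod q) : 0 ≤ stepWeight (twist C S T k) ω :=
    stepWeight_nonneg hcos (neg_half_le_twist hC S T k) (twist_mul_le_one hC hC1 S T k) ω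
  have lower := prod_mul_card_sq_le_sum_sum_prod_sub
    (ψ := AddChar.mulShift (ZMod.stdAddChar (N := q))) (ω₀ := 0)
    (fun k => stepKernel_eq_sum_stdAddChar (twist C S T k)) weight_nonneg
    (AddChar.mulShift_zero _) c
  simp_rw [confusionKernel_mul_krawtchoukProd]
  refine le_trans (mul_le_mul_of_nonneg_right ?_ (sq_nonneg _)) lower
  split_ifs with h
  · subst h
    simp_rw [stepWeight_twist_self hC, Finset.prod_mul_distrib, Finset.prod_ite_mem,
      Finset.univ_inter, Finset.prod_const, Finset.card_univ, le_refl]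
  · exact Finset.prod_nonneg fun k _ => weight_nonneg k 0

theorem sum_sum_confusionKernel_mul_krawtchoukSum_ge (hC : 0 < C) (hC1 : C ≤ 1)
    (hcos : ∀ ω : ZMod q, -C ≤ Real.cos (2 * π * ω.val / q)) (c : ι → κ → ZMod q)
    {e b : Finset κ → ℝ} (he : ∀ S, 0 ≤ e S) (hb : ∀ S, 0 ≤ b S) :
    ((1 + C) / (C * q)) ^ Fintype.card κ * (∑ S, e S * b S * C ^ S.card)
        * (Fintype.card ι : ℝ) ^ 2
      ≤ ∑ i, ∑ j, confusionKernel C (c i - c j)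
        * (krawtchoukSum C e (c i - c j) * krawtchoukSum C b (c i - c j)) := by
  classical
  have expand : ∑ i, ∑ j, confusionKernel C (c i - c j)
        * (krawtchoukSum C e (c i - c j) * krawtchoukSum C b (c i - c j))
      = ∑ S, ∑ T, e S * b T * ∑ i, ∑ j, confusionKernel C (c i - c j)
        * (krawtchoukProd C S (c i - c j) * krawtchoukProd C T (c i - c j)) := by
    simp_rw [krawtchoukSum, Finset.sum_mul_sum, Finset.mul_sum]
    rw [Finset.sum_congr rfl fun i _ => Finset.sum_comm, Finset.sum_comm]
    refine Finset.sum_congr rfl fun S _ => ?_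
    rw [Finset.sum_congr rfl fun i _ => Finset.sum_comm, Finset.sum_comm]
    exact Finset.sum_congr rfl fun T _ => Finset.sum_congr rfl fun i _ =>
      Finset.sum_congr rfl fun j _ => by ring
  calc ((1 + C) / (C * q)) ^ Fintype.card κ * (∑ S, e S * b S * C ^ S.card)
        * (Fintype.card ι : ℝ) ^ 2
      = ∑ S, ∑ T, e S * b T
          * ((if S = T then ((1 + C) / (C * q)) ^ Fintype.card κ * C ^ S.card else 0)
            * (Fintype.card ι : ℝ) ^ 2) := by
        simp only [ite_mul, zero_mul, mul_ite, mul_zero, Finset.sum_ite_eq, Finset.mem_univ,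
          if_true, Finset.mul_sum, Finset.sum_mul]
        exact Finset.sum_congr rfl fun S _ => by ring
    _ ≤ _ := by
        rw [expand]
        gcongr with S _ T _
        · exact mul_nonneg (he S) (hb T)
        · exact sum_sum_confusionKernel_mul_krawtchoukProd_ge hC hC1 hcos c S T

omit [NeZero q] in
theorem sum_sum_confusionKernel_mul_le (hC : 0 < C) {c : ι → κ → ZMod q}
    (hc : HasConfusableDist d c) (b : Finset κ → ℝ) :
    ∑ i, ∑ j, confusionKernel C (c i - c j)
        * ((∑ k, krawtchouk C ((c i - c j) k) - (Fintype.card κ - (1 + C) * d))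
          * krawtchoukSum C b (c i - c j) ^ 2)
      ≤ Fintype.card ι * ((1 + C) * d * (∑ S, b S) ^ 2) := by
  classical
  have term_le (i j : ι) : confusionKernel C (c i - c j)
        * ((∑ k, krawtchouk C ((c i - c j) k) - (Fintype.card κ - (1 + C) * d))
          * krawtchoukSum C b (c i - c j) ^ 2)
      ≤ if i = j then (1 + C) * d * (∑ S, b S) ^ 2 else 0 := by
    split_ifs with hij
    · simp [hij, confusionKernel, krawtchoukSum, krawtchoukProd, krawtchouk, stepKernel_zero]
    by_cases h_conf : ∀ k, Confusable (c i k) (c j k)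
    · have sum_le : ∑ k, krawtchouk C ((c i - c j) k) ≤ Fintype.card κ - (1 + C) * d := by
        simp only [Pi.sub_apply, sum_krawtchouk_sub]
        gcongr
        exact hc hij h_conf
      exact mul_nonpos_of_nonneg_of_nonpos (confusionKernel_nonneg hC _)
        (mul_nonpos_of_nonpos_of_nonneg (sub_nonpos.mpr sum_le) (sq_nonneg _))
    · rw [confusionKernel_sub_eq_zero h_conf, zero_mul]
  refine (Finset.sum_le_sum fun i _ => Finset.sum_le_sum fun j _ => term_le i j).trans_eq ?_
  simp

theorem sq_sum_le_sum_inv_mul_sum_sq_mul {α : Type*} [Fintype α] {b w : α → ℝ} {V : Finset α}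
    (hV : ∀ x ∉ V, b x = 0) (hw : ∀ x, 0 < w x) :
    (∑ x, b x) ^ 2 ≤ (∑ x ∈ V, (w x)⁻¹) * ∑ x, b x ^ 2 * w x := by
  rw [← Finset.sum_subset V.subset_univ fun x _ => hV x]
  rw [← Finset.sum_subset V.subset_univ fun x _ hx => by rw [hV x hx]; ring]
  refine Finset.sum_sq_le_sum_mul_sum_of_sq_le_mul V (fun x _ => (inv_pos.mpr (hw x)).le)
    (fun x _ => mul_nonneg (sq_nonneg _) (hw x).le) fun x _ => le_of_eq ?_
  field_simp [(hw x).ne']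

-- The kernel is tested against `(P - lam) * φ ^ 2`, where `P` is the sum of the polynomials of
-- degree one, `φ` has the coefficients `b` and `lam` is the value of `P` at distance `d`: only the
-- diagonal pairs contribute positively.
theorem card_mul_le_of_mul_le_recurrence [DecidableEq κ] (hC : 0 < C) (hC1 : C ≤ 1)
    (hcos : ∀ ω : ZMod q, -C ≤ Real.cos (2 * π * ω.val / q)) {c : ι → κ → ZMod q} (hd : 0 ≤ d)
    (hc : HasConfusableDist d c) {b : Finset κ → ℝ} (hb : ∀ S, 0 ≤ b S) (hb_pos : ∃ S, 0 < b S)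
    {V : Finset (Finset κ)} (hV : ∀ S ∉ V, b S = 0) {ε : ℝ} (hε : 0 < ε)
    (hrec : ∀ S, (Fintype.card κ - (1 + C) * d + ε) * b S ≤ recurrence C b S) :
    ε * ((1 + C) / (C * q)) ^ Fintype.card κ * Fintype.card ι
      ≤ (1 + C) * d * ∑ S ∈ V, C⁻¹ ^ S.card := by
  set lam : ℝ := Fintype.card κ - (1 + C) * d
  set A : ℝ := ((1 + C) / (C * q)) ^ Fintype.card κ
  set N : ℝ := ∑ S, b S ^ 2 * C ^ S.card with N_def
  set e : Finset κ → ℝ := fun S => recurrence C b S - lam * b S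
  have N_pos : 0 < N :=
    Finset.sum_pos' (fun S _ => by positivity)
      (hb_pos.imp fun S hS => ⟨Finset.mem_univ S, by positivity⟩)
  have le_e (S : Finset κ) : ε * b S ≤ e S := by linarith [hrec S]
  have e_nonneg (S : Finset κ) : 0 ≤ e S := (mul_nonneg hε.le (hb S)).trans (le_e S)
  have krawtchoukSum_e (z : κ → ZMod q) :
      krawtchoukSum C e z = (∑ k, krawtchouk C (z k) - lam) * krawtchoukSum C b z := by
    rw [sub_mul, sum_krawtchouk_mul_krawtchoukSum]
    simp only [krawtchoukSum, e, sub_mul, Finset.sum_sub_distrib, Finset.mul_sum, mul_assoc]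
  have le_sum : ε * N ≤ ∑ S, e S * b S * C ^ S.card := by
    rw [N_def, Finset.mul_sum]
    refine Finset.sum_le_sum fun S _ => ?_
    rw [sq, ← mul_assoc, ← mul_assoc]
    exact mul_le_mul_of_nonneg_right (mul_le_mul_of_nonneg_right (le_e S) (hb S)) (by positivity)
  have le_sum_sum := sum_sum_confusionKernel_mul_krawtchoukSum_ge hC hC1 hcos c e_nonneg hb
  simp only [krawtchoukSum_e, mul_assoc (_ - lam), ← sq (krawtchoukSum C b _)] at le_sum_sum
  have sum_sq_le : (∑ S, b S) ^ 2 ≤ (∑ S ∈ V, C⁻¹ ^ S.card) * N := by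
    simpa only [inv_pow] using sq_sum_le_sum_inv_mul_sum_sq_mul hV fun S => pow_pos hC S.card
  have combined : A * (ε * N) * (Fintype.card ι : ℝ) ^ 2
      ≤ Fintype.card ι * ((1 + C) * d * ((∑ S ∈ V, C⁻¹ ^ S.card) * N)) :=
    calc A * (ε * N) * (Fintype.card ι : ℝ) ^ 2
        ≤ A * (∑ S, e S * b S * C ^ S.card) * (Fintype.card ι : ℝ) ^ 2 := by gcongr
      _ ≤ Fintype.card ι * ((1 + C) * d * (∑ S, b S) ^ 2) :=
        le_sum_sum.trans (sum_sum_confusionKernel_mul_le hC hc b)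
      _ ≤ _ := by gcongr
  rcases (Nat.cast_nonneg (α := ℝ) (Fintype.card ι)).eq_or_lt with h_card | h_card
  · rw [← h_card, mul_zero]
    positivity
  · refine le_of_mul_le_mul_right ?_ (mul_pos N_pos h_card)
    linarith

end LinearProgram

section Window

/-- A sine wave on the interval from `a` to `a + m`, scaled by a geometric factor. It serves as an
approximate eigenvector of the three-term recurrence. -/
noncomputable def window (θ : ℝ) (a m s : ℕ) : ℝ :=
  if a ≤ s ∧ s ≤ a + m then θ ^ s * Real.sin (π * (s - a + 1) / (m + 2)) else 0

/-- A lower bound, by `mul_window_le`, for the factor by which the three-term recurrence in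
dimension `n` stretches a window from `a` to `a + m` with the best choice of `θ`. -/
noncomputable def windowEigenvalue (C : ℝ) (n a m : ℕ) : ℝ :=
  2 * √(a * (n - a - m) * C) * Real.cos (π / (m + 2)) + (1 - C) * a

variable {θ C : ℝ} {a m n s : ℕ}

theorem window_eq_zero (h : ¬(a ≤ s ∧ s ≤ a + m)) : window θ a m s = 0 := if_neg h

theorem window_nonneg (hθ : 0 ≤ θ) (a m s : ℕ) : 0 ≤ window θ a m s := by
  unfold window
  split_ifs with h
  · have h_lower : (a : ℝ) ≤ s := by exact_mod_cast h.1
    have h_upper : (s : ℝ) ≤ a + m := by exact_mod_cast h.2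
    refine mul_nonneg (by positivity) (Real.sin_nonneg_of_nonneg_of_le_pi ?_ ?_)
    · exact div_nonneg (mul_nonneg Real.pi_nonneg (by linarith)) (by positivity)
    · rw [div_le_iff₀ (by positivity)]
      exact mul_le_mul_of_nonneg_left (by linarith) Real.pi_nonneg
  · exact le_rfl

theorem window_pos (hθ : 0 < θ) (a m : ℕ) : 0 < window θ a m a := by
  rw [window, if_pos (by omega), sub_self, zero_add, mul_one]
  refine mul_pos (by positivity) (Real.sin_pos_of_pos_of_lt_pi (by positivity) ?_)
  exact div_lt_self Real.pi_pos (by linarith [Nat.cast_nonneg (α := ℝ) m])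

-- The sine vanishes one step outside of the window on either side.
theorem window_eq (θ : ℝ) (h_lower : a ≤ s + 1) (h_upper : s ≤ a + m + 1) :
    window θ a m s = θ ^ s * Real.sin (π * (s - a + 1) / (m + 2)) := by
  unfold window
  split_ifs with h
  · rfl
  · obtain rfl | rfl : a = s + 1 ∨ s = a + m + 1 := by omega
    · simp
    · have angle_eq : π * (((a + m + 1 : ℕ) : ℝ) - a + 1) / (m + 2) = π := by
        push_cast
        field_simp
        ring
      rw [angle_eq, Real.sin_pi, mul_zero]

theorem window_recurrence (θ : ℝ) (h_lower : a ≤ s + 1) (h_upper : s + 1 ≤ a + m) :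
    θ ^ 2 * window θ a m s + window θ a m (s + 2)
      = 2 * θ * Real.cos (π / (m + 2)) * window θ a m (s + 1) := by
  rw [window_eq θ h_lower (by omega), window_eq θ (s := s + 1) (by omega) (by omega),
    window_eq θ (s := s + 2) (by omega) (by omega)]
  set x := π * ((s + 1 : ℕ) - a + 1) / (m + 2) with x_def
  have x_sub : π * (s - a + 1) / (m + 2) = x - π / (m + 2) := by
    rw [x_def]; push_cast; ring
  have x_add : π * ((s + 2 : ℕ) - a + 1) / (m + 2) = x + π / (m + 2) := by
    rw [x_def]; push_cast; ring
  rw [x_sub, x_add, Real.sin_sub, Real.sin_add]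
  ring

theorem mul_window_le (hC : 0 ≤ C) (hC1 : C ≤ 1) (hθ : 0 ≤ θ)
    (hθ_sq : (n - a - m) * C * θ ^ 2 = a) (ha : 1 ≤ a) (hs : s ≤ n) :
    (2 * ((n - a - m) * C * θ) * Real.cos (π / (m + 2)) + (1 - C) * a) * window θ a m s
      ≤ s * (window θ a m (s - 1) + (1 - C) * window θ a m s)
        + (n - s) * (C * window θ a m (s + 1)) := by
  have hs' : (0 : ℝ) ≤ n - s := sub_nonneg.mpr (by exact_mod_cast hs)
  have hC1' : 0 ≤ 1 - C := sub_nonneg.mpr hC1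
  have nonneg := window_nonneg hθ a m
  by_cases h : a ≤ s ∧ s ≤ a + m
  · obtain ⟨t, rfl⟩ : ∃ t, s = t + 1 := ⟨s - 1, by omega⟩
    have h_lower : (a : ℝ) ≤ (t + 1 : ℕ) := by exact_mod_cast h.1
    have h_upper : (n : ℝ) - a - m ≤ n - (t + 1 : ℕ) := by
      have : ((t + 1 : ℕ) : ℝ) ≤ a + m := by exact_mod_cast h.2
      linarith
    calc (2 * ((n - a - m) * C * θ) * Real.cos (π / (m + 2)) + (1 - C) * a)
          * window θ a m (t + 1)
        = a * (window θ a m t + (1 - C) * window θ a m (t + 1))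
          + (n - a - m) * (C * window θ a m (t + 2)) := by
          linear_combination window θ a m t * hθ_sq
            - (n - a - m) * C * window_recurrence θ h.1 h.2
      _ ≤ _ := by
          rw [add_tsub_cancel_right]
          gcongr
          · exact add_nonneg (nonneg _) (mul_nonneg hC1' (nonneg _))
          · exact mul_nonneg hC (nonneg _)
  · rw [window_eq_zero h, mul_zero, mul_zero, add_zero]
    exact add_nonneg (mul_nonneg (Nat.cast_nonneg s) (nonneg _))
      (mul_nonneg hs' (mul_nonneg hC (nonneg _)))

end Window

section HammingBall

theorem recurrence_comp_card {κ : Type*} [Fintype κ] [DecidableEq κ] (C : ℝ) (f : ℕ → ℝ)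
    (S : Finset κ) :
    recurrence C (fun S => f S.card) S
      = S.card * (f (S.card - 1) + (1 - C) * f S.card)
        + (Fintype.card κ - S.card) * (C * f (S.card + 1)) := by
  rw [recurrence, Finset.sum_congr rfl fun k hk => by rw [Finset.card_erase_of_mem hk],
    Finset.sum_congr (s₁ := Sᶜ) rfl fun k hk => by
      rw [Finset.card_insert_of_notMem (Finset.mem_compl.mp hk)],
    Finset.sum_const, Finset.sum_const, nsmul_eq_mul, nsmul_eq_mul, Finset.card_compl,
    Nat.cast_sub (Finset.card_le_univ S)]

theorem card_mul_le_sum_inv_pow_card {q : ℕ} [NeZero q] [Nontrivial (ZMod q)] {ι κ : Type*}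
    [Fintype ι] [Fintype κ] {C d : ℝ} (hC : 0 < C) (hC1 : C ≤ 1)
    (hcos : ∀ ω : ZMod q, -C ≤ Real.cos (2 * π * ω.val / q)) {c : ι → κ → ZMod q} (hd : 0 ≤ d)
    (hc : HasConfusableDist d c) {a m : ℕ} (ha : 1 ≤ a) (ham : a + m < Fintype.card κ) {ε : ℝ}
    (hε : 0 < ε)
    (h_eig : Fintype.card κ - (1 + C) * d + ε ≤ windowEigenvalue C (Fintype.card κ) a m) :
    ε * ((1 + C) / (C * q)) ^ Fintype.card κ * Fintype.card ι
      ≤ (1 + C) * d * ∑ S : Finset κ with S.card ≤ a + m, C⁻¹ ^ S.card := by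
  classical
  have : (0 : ℝ) < a := by exact_mod_cast ha
  set N : ℝ := Fintype.card κ - a - m
  have N_pos : 0 < N := by
    have : (a + m : ℝ) < Fintype.card κ := by exact_mod_cast ham
    linarith
  set θ := √(a / (N * C))
  have hθ : 0 < θ := Real.sqrt_pos.mpr (by positivity)
  have hθ_sq : N * C * θ ^ 2 = a := by
    rw [Real.sq_sqrt (by positivity)]
    field_simp
  have hθ_sqrt : √(a * N * C) = N * C * θ := by
    rw [← hθ_sq, ← Real.sqrt_sq (by positivity : 0 ≤ N * C * θ)]
    congr 1
    ring
  obtain ⟨S₀, -, hS₀⟩ := Finset.exists_subset_card_eq (s := (Finset.univ : Finset κ)) (n := a)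
    (by rw [Finset.card_univ]; omega)
  refine card_mul_le_of_mul_le_recurrence hC hC1 hcos hd hc
    (b := fun S => window θ a m S.card) (fun S => window_nonneg hθ.le a m S.card)
    ⟨S₀, hS₀ ▸ window_pos hθ _ m⟩ (fun S hS => window_eq_zero (by simp at hS; omega)) hε fun S => ?_
  rw [recurrence_comp_card C (window θ a m)]
  refine le_trans (mul_le_mul_of_nonneg_right ?_ (window_nonneg hθ.le a m S.card))
    (mul_window_le hC.le hC1 hθ.le hθ_sq ha (Finset.card_le_univ S))
  rwa [← hθ_sqrt]

end HammingBall

section Entropy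

variable {Q t τ : ℝ}

theorem entropy_eq (Q t : ℝ) :
    entropy Q t = (t * Real.log (Q - 1) + Real.binEntropy t) / Real.log 2 := by
  simp only [entropy, Real.logb, Real.binEntropy, Real.log_inv]
  ring

theorem entropy_continuous (Q : ℝ) : Continuous (entropy Q) := by
  simp_rw [funext (entropy_eq Q)]
  fun_prop

theorem hasDerivAt_entropy (Q : ℝ) (ht0 : t ≠ 0) (ht1 : t ≠ 1) :
    HasDerivAt (entropy Q)
      ((Real.log (Q - 1) + (Real.log (1 - t) - Real.log t)) / Real.log 2) t := by
  rw [funext (entropy_eq Q)]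
  simpa using (((hasDerivAt_id t).mul_const (Real.log (Q - 1))).add
    (Real.hasDerivAt_binEntropy ht0 ht1)).div_const (Real.log 2)

theorem one_sub_inv_mem_Ioo (hQ : 1 < Q) : 1 - 1 / Q ∈ Ioo 0 1 :=
  ⟨sub_pos.mpr ((div_lt_one (by linarith)).mpr hQ), sub_lt_self 1 (by positivity)⟩

theorem lt_sub_one_mul_one_sub (hQ : 1 < Q) (ht : t < 1 - 1 / Q) : t < (Q - 1) * (1 - t) := by
  rw [← sub_pos] at ht ⊢
  have : (Q - 1) * (1 - t) - t = Q * (1 - 1 / Q - t) := by field_simp; ring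
  rw [this]
  positivity

theorem entropy_strictMonoOn (hQ : 1 < Q) : StrictMonoOn (entropy Q) (Icc 0 (1 - 1 / Q)) := by
  refine strictMonoOn_of_deriv_pos (convex_Icc _ _) (entropy_continuous Q).continuousOn ?_
  rw [interior_Icc]
  intro t ht
  have ht1 : t < 1 := ht.2.trans (one_sub_inv_mem_Ioo hQ).2
  rw [(hasDerivAt_entropy Q ht.1.ne' ht1.ne).deriv]
  refine div_pos ?_ (Real.log_pos one_lt_two)
  rw [← add_sub_assoc, sub_pos, ← Real.log_mul (by linarith) (by linarith)]
  exact Real.log_lt_log ht.1 (lt_sub_one_mul_one_sub hQ ht.2)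

theorem entropy_zero (Q : ℝ) : entropy Q 0 = 0 := by simp [entropy]

theorem entropy_one_sub_inv (hQ : 1 < Q) : entropy Q (1 - 1 / Q) = Real.logb 2 Q := by
  have h_eq : 1 - 1 / Q = (Q - 1) / Q := by field_simp
  rw [entropy, sub_sub_cancel, h_eq, Real.logb_div (by linarith) (by linarith),
    Real.logb_div one_ne_zero (by linarith), Real.logb_one]
  field_simp
  ring

theorem entropy_bijOn (hQ : 1 < Q) :
    BijOn (entropy Q) (Icc 0 (1 - 1 / Q)) (Icc 0 (Real.logb 2 Q)) := by
  have h_nonneg := (one_sub_inv_mem_Ioo hQ).1.le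
  have mono := entropy_strictMonoOn hQ
  have surj := intermediate_value_Icc h_nonneg (entropy_continuous Q).continuousOn
  have maps := mono.monotoneOn.mapsTo_Icc
  rw [entropy_zero, entropy_one_sub_inv hQ] at surj maps
  exact ⟨maps, mono.injOn, surj⟩

end Entropy

section KrawtchoukRoot

variable {Q s t x r R δ : ℝ}

/-- The limit of the first root of the Krawtchouk polynomial of degree `t * n` and length `n`,
divided by `n`, for the alphabet size `Q`. -/
noncomputable def krawtchoukRoot (Q t : ℝ) : ℝ :=
  ((Q - 1) - (Q - 2) * t - 2 * √((Q - 1) * t * (1 - t))) / Q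

/-- The angle `β` with `sin β ^ 2 = 1 - 1 / Q`, for which `krawtchoukRoot Q` becomes the reflection
`x ↦ β - x` in the variable `x` with `t = sin x ^ 2`. -/
noncomputable def criticalAngle (Q : ℝ) : ℝ := Real.arcsin √(1 - 1 / Q)

theorem criticalAngle_mem (Q : ℝ) : criticalAngle Q ∈ Icc 0 (π / 2) :=
  ⟨Real.arcsin_nonneg.mpr (Real.sqrt_nonneg _), Real.arcsin_le_pi_div_two _⟩

theorem sin_criticalAngle (hQ : 1 < Q) : Real.sin (criticalAngle Q) = √(1 - 1 / Q) :=
  Real.sin_arcsin (by linarith [Real.sqrt_nonneg (1 - 1 / Q)])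
    (Real.sqrt_le_one.mpr (one_sub_inv_mem_Ioo hQ).2.le)

theorem sin_sq_criticalAngle (hQ : 1 < Q) : Real.sin (criticalAngle Q) ^ 2 = 1 - 1 / Q := by
  rw [sin_criticalAngle hQ, Real.sq_sqrt (one_sub_inv_mem_Ioo hQ).1.le]

theorem cos_criticalAngle (hQ : 1 < Q) : Real.cos (criticalAngle Q) = √(1 / Q) := by
  rw [criticalAngle, Real.cos_arcsin, Real.sq_sqrt (one_sub_inv_mem_Ioo hQ).1.le, sub_sub_cancel]

theorem sin_mul_cos_criticalAngle (hQ : 1 < Q) :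
    Real.sin (criticalAngle Q) * Real.cos (criticalAngle Q) = √(Q - 1) / Q := by
  have h_eq : (1 - 1 / Q) * (1 / Q) = (Q - 1) / Q ^ 2 := by field_simp
  rw [sin_criticalAngle hQ, cos_criticalAngle hQ, ← Real.sqrt_mul (one_sub_inv_mem_Ioo hQ).1.le,
    h_eq, Real.sqrt_div' _ (sq_nonneg Q), Real.sqrt_sq (by linarith)]

theorem krawtchoukRoot_sin_sq (hQ : 1 < Q) (hx : x ∈ Icc 0 (π / 2)) :
    krawtchoukRoot Q (Real.sin x ^ 2) = Real.sin (criticalAngle Q - x) ^ 2 := by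
  have sin_nonneg : 0 ≤ Real.sin x :=
    Real.sin_nonneg_of_nonneg_of_le_pi hx.1 (by linarith [hx.2, Real.pi_pos])
  have cos_nonneg : 0 ≤ Real.cos x :=
    Real.cos_nonneg_of_mem_Icc ⟨by linarith [hx.1, Real.pi_pos], hx.2⟩
  have sqrt_eq : √((Q - 1) * Real.sin x ^ 2 * (1 - Real.sin x ^ 2))
      = √(Q - 1) * (Real.sin x * Real.cos x) := by
    rw [← Real.cos_sq', mul_assoc, ← mul_pow, Real.sqrt_mul (by linarith),
      Real.sqrt_sq (by positivity)]
  have expand : Real.sin (criticalAngle Q - x) ^ 2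
      = (1 - 1 / Q) * (1 - Real.sin x ^ 2) + 1 / Q * Real.sin x ^ 2
        - 2 * (√(Q - 1) / Q) * (Real.sin x * Real.cos x) := by
    rw [Real.sin_sub, ← sin_mul_cos_criticalAngle hQ, ← sin_sq_criticalAngle hQ, ← Real.cos_sq',
      ← Real.sq_sqrt (show 0 ≤ 1 / Q by positivity), ← cos_criticalAngle hQ]
    ring
  rw [expand, krawtchoukRoot, sqrt_eq]
  field_simp
  ring

theorem sin_sq_strictMonoOn : StrictMonoOn (fun x => Real.sin x ^ 2) (Icc 0 (π / 2)) :=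
  fun x hx y hy hxy => pow_lt_pow_left₀
    (Real.sin_lt_sin_of_lt_of_le_pi_div_two (by linarith [hx.1, Real.pi_pos]) hy.2 hxy)
    (Real.sin_nonneg_of_nonneg_of_le_pi hx.1 (by linarith [hx.2, Real.pi_pos])) two_ne_zero

theorem Icc_criticalAngle_subset (Q : ℝ) : Icc 0 (criticalAngle Q) ⊆ Icc 0 (π / 2) :=
  Icc_subset_Icc_right (criticalAngle_mem Q).2

theorem sub_mem_Icc_criticalAngle (hx : x ∈ Icc 0 (criticalAngle Q)) :
    criticalAngle Q - x ∈ Icc 0 (criticalAngle Q) :=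
  ⟨sub_nonneg.mpr hx.2, sub_le_self _ hx.1⟩

theorem image_sin_sq_Icc_criticalAngle (hQ : 1 < Q) :
    (fun x => Real.sin x ^ 2) '' Icc 0 (criticalAngle Q) = Icc 0 (1 - 1 / Q) := by
  have mono := (sin_sq_strictMonoOn.mono (Icc_criticalAngle_subset Q)).monotoneOn
  have surj := intermediate_value_Icc (criticalAngle_mem Q).1
    (f := fun x => Real.sin x ^ 2) (by fun_prop)
  have maps := mono.mapsTo_Icc
  simp only [Real.sin_zero, sin_sq_criticalAngle hQ, ne_eq, OfNat.ofNat_ne_zero, not_false_eq_true,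
    zero_pow] at surj maps
  exact maps.image_subset.antisymm surj

theorem krawtchoukRoot_mapsTo (hQ : 1 < Q) :
    MapsTo (krawtchoukRoot Q) (Icc 0 (1 - 1 / Q)) (Icc 0 (1 - 1 / Q)) := by
  rw [← image_sin_sq_Icc_criticalAngle hQ]
  rintro - ⟨x, hx, rfl⟩
  exact ⟨_, sub_mem_Icc_criticalAngle hx,
    (krawtchoukRoot_sin_sq hQ (Icc_criticalAngle_subset Q hx)).symm⟩

theorem krawtchoukRoot_krawtchoukRoot (hQ : 1 < Q) (ht : t ∈ Icc 0 (1 - 1 / Q)) :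
    krawtchoukRoot Q (krawtchoukRoot Q t) = t := by
  rw [← image_sin_sq_Icc_criticalAngle hQ] at ht
  obtain ⟨x, hx, rfl⟩ := ht
  rw [krawtchoukRoot_sin_sq hQ (Icc_criticalAngle_subset Q hx),
    krawtchoukRoot_sin_sq hQ (Icc_criticalAngle_subset Q (sub_mem_Icc_criticalAngle hx)),
    sub_sub_cancel]

theorem krawtchoukRoot_strictAntiOn (hQ : 1 < Q) :
    StrictAntiOn (krawtchoukRoot Q) (Icc 0 (1 - 1 / Q)) := by
  rw [← image_sin_sq_Icc_criticalAngle hQ]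
  rintro - ⟨x, hx, rfl⟩ - ⟨y, hy, rfl⟩ hxy
  have hx' := Icc_criticalAngle_subset Q hx
  have hy' := Icc_criticalAngle_subset Q hy
  rw [krawtchoukRoot_sin_sq hQ hx', krawtchoukRoot_sin_sq hQ hy']
  exact sin_sq_strictMonoOn (Icc_criticalAngle_subset Q (sub_mem_Icc_criticalAngle hy))
    (Icc_criticalAngle_subset Q (sub_mem_Icc_criticalAngle hx))
    (sub_lt_sub_left ((sin_sq_strictMonoOn.lt_iff_lt hx' hy').mp hxy) _)

theorem krawtchoukRoot_one_sub_inv (hQ : 1 < Q) : krawtchoukRoot Q (1 - 1 / Q) = 0 := by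
  rw [← sin_sq_criticalAngle hQ, krawtchoukRoot_sin_sq hQ (criticalAngle_mem Q), sub_self,
    Real.sin_zero, zero_pow two_ne_zero]

theorem rateLP1_bijOn (hQ : 1 < Q) (r : ℝ) :
    BijOn (rateLP1 r Q) (Icc 0 (1 - 1 / Q)) (Icc r (r + Real.logb 2 Q)) := by
  have root_bijOn : BijOn (krawtchoukRoot Q) (Icc 0 (1 - 1 / Q)) (Icc 0 (1 - 1 / Q)) :=
    ⟨krawtchoukRoot_mapsTo hQ, (krawtchoukRoot_strictAntiOn hQ).injOn, fun t ht =>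
      ⟨_, krawtchoukRoot_mapsTo hQ ht, krawtchoukRoot_krawtchoukRoot hQ ht⟩⟩
  have add_bijOn : BijOn (r + ·) (Icc 0 (Real.logb 2 Q)) (Icc r (r + Real.logb 2 Q)) := by
    have := (add_right_injective r).injOn.bijOn_image (s := Icc 0 (Real.logb 2 Q))
    rwa [image_const_add_Icc, add_zero] at this
  exact add_bijOn.comp ((entropy_bijOn hQ).comp root_bijOn)

theorem ELP1_mem (hQ : 1 < Q) (hR : R ∈ Icc r (r + Real.logb 2 Q)) :
    ELP1 r Q R ∈ Icc 0 (1 - 1 / Q) :=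
  (rateLP1_bijOn hQ r).surjOn.mapsTo_invFunOn hR

theorem add_entropy_krawtchoukRoot_ELP1 (hQ : 1 < Q) (hR : R ∈ Icc r (r + Real.logb 2 Q)) :
    r + entropy Q (krawtchoukRoot Q (ELP1 r Q R)) = R :=
  (rateLP1_bijOn hQ r).surjOn.rightInvOn_invFunOn hR

theorem ELP1_lt_one_sub_inv (hQ : 1 < Q) (hR : R ∈ Ioc r (r + Real.logb 2 Q)) :
    ELP1 r Q R < 1 - 1 / Q := by
  have hR' := Ioc_subset_Icc_self hR
  refine (ELP1_mem hQ hR').2.lt_of_ne fun h_eq => hR.1.ne ?_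
  rw [← add_entropy_krawtchoukRoot_ELP1 hQ hR', h_eq, krawtchoukRoot_one_sub_inv hQ, entropy_zero,
    add_zero]

theorem exists_krawtchoukRoot_lt (hQ : 1 < Q) (hR : R ∈ Ioc r (r + Real.logb 2 Q))
    (hδ : ELP1 r Q R < δ) :
    ∃ τ ∈ Ioo 0 (1 - 1 / Q), krawtchoukRoot Q τ < δ ∧ r + entropy Q τ < R := by
  have hR' := Ioc_subset_Icc_self hR
  have E_mem := ELP1_mem hQ hR'
  have anti := krawtchoukRoot_strictAntiOn hQ
  obtain ⟨δ', E_lt, lt_min⟩ := exists_between (lt_min hδ (ELP1_lt_one_sub_inv hQ hR))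
  obtain ⟨lt_δ, lt_top⟩ := lt_min_iff.mp lt_min
  have δ'_mem : δ' ∈ Icc 0 (1 - 1 / Q) := ⟨E_mem.1.trans E_lt.le, lt_top.le⟩
  have root_lt := anti E_mem δ'_mem E_lt
  refine ⟨krawtchoukRoot Q δ', ⟨?_, root_lt.trans_le (krawtchoukRoot_mapsTo hQ E_mem).2⟩, ?_, ?_⟩
  · rw [← krawtchoukRoot_one_sub_inv hQ]
    exact anti δ'_mem (right_mem_Icc.mpr (one_sub_inv_mem_Ioo hQ).1.le) lt_top
  · rwa [krawtchoukRoot_krawtchoukRoot hQ δ'_mem]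
  · rw [← add_entropy_krawtchoukRoot_ELP1 hQ hR']
    gcongr
    exact entropy_strictMonoOn hQ (krawtchoukRoot_mapsTo hQ δ'_mem)
      (krawtchoukRoot_mapsTo hQ E_mem) root_lt

end KrawtchoukRoot

section BallVolume

variable {Q τ : ℝ}

theorem rpow_neg_mul_add_one_eq_two_rpow_entropy (hQ : 1 < Q) (hτ : τ ∈ Ioo 0 1) :
    (τ / ((1 - τ) * (Q - 1))) ^ (-τ) * ((Q - 1) * (τ / ((1 - τ) * (Q - 1))) + 1)
      = 2 ^ entropy Q τ := by
  have h_sub : 0 < 1 - τ := sub_pos.mpr hτ.2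
  have hQ' : 0 < Q - 1 := sub_pos.mpr hQ
  have base_pos : 0 < τ / ((1 - τ) * (Q - 1)) := div_pos hτ.1 (by positivity)
  have factor_eq :
      (Q - 1) * (τ / ((1 - τ) * (Q - 1))) + 1 = Real.exp (-Real.log (1 - τ)) := by
    rw [Real.exp_neg, Real.exp_log h_sub]
    field_simp
    ring
  rw [factor_eq, Real.rpow_def_of_pos base_pos, Real.rpow_def_of_pos two_pos, ← Real.exp_add,
    Real.log_div hτ.1.ne' (by positivity), Real.log_mul h_sub.ne' hQ'.ne', entropy]
  have := Real.log_pos one_lt_two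
  simp only [Real.logb]
  congr 1
  field_simp
  ring

-- Chernoff's argument: `z ^ (|S| - τ n) ≥ 1` on the ball for every `z ≤ 1`, and the binomial
-- theorem sums the weights `((Q - 1) * z) ^ |S|` over all sets.
theorem sum_pow_card_le_two_rpow_entropy {κ : Type*} [Fintype κ] {r : ℕ} (hQ : 1 < Q)
    (hτ : τ ∈ Ioo 0 (1 - 1 / Q)) (hr : r ≤ τ * Fintype.card κ) :
    ∑ S : Finset κ with S.card ≤ r, (Q - 1) ^ S.card
      ≤ (2 : ℝ) ^ (Fintype.card κ * entropy Q τ) := by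
  have hτ1 : τ < 1 := hτ.2.trans (one_sub_inv_mem_Ioo hQ).2
  have hQ' : 0 < Q - 1 := sub_pos.mpr hQ
  set z := τ / ((1 - τ) * (Q - 1)) with z_def
  have z_pos : 0 < z := div_pos hτ.1 (mul_pos (sub_pos.mpr hτ1) hQ')
  have z_le_one : z ≤ 1 := by
    rw [div_le_one (mul_pos (sub_pos.mpr hτ1) hQ'), mul_comm]
    exact (lt_sub_one_mul_one_sub hQ hτ.2).le
  have term_le (S : Finset κ) (hS : S.card ≤ r) :
      (Q - 1) ^ S.card ≤ z ^ (-(τ * Fintype.card κ)) * ((Q - 1) * z) ^ S.card := by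
    have card_le : (S.card : ℝ) ≤ τ * Fintype.card κ := le_trans (by exact_mod_cast hS) hr
    have one_le : 1 ≤ z ^ (-(τ * Fintype.card κ)) * z ^ S.card := by
      rw [← Real.rpow_natCast, ← Real.rpow_add z_pos]
      exact Real.one_le_rpow_of_pos_of_le_one_of_nonpos z_pos z_le_one (by linarith)
    rw [mul_pow, mul_left_comm]
    exact le_mul_of_one_le_right (by positivity) one_le
  calc ∑ S : Finset κ with S.card ≤ r, (Q - 1) ^ S.card
      ≤ ∑ S : Finset κ with S.card ≤ r, z ^ (-(τ * Fintype.card κ)) * ((Q - 1) * z) ^ S.card :=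
        Finset.sum_le_sum fun S hS => term_le S (by simpa using hS)
    _ ≤ ∑ S : Finset κ, z ^ (-(τ * Fintype.card κ)) * ((Q - 1) * z) ^ S.card :=
        Finset.sum_le_univ_sum_of_nonneg fun S => by positivity
    _ = z ^ (-(τ * Fintype.card κ)) * ((Q - 1) * z + 1) ^ Fintype.card κ := by
        rw [← Finset.mul_sum]
        congr 1
        simpa using Fintype.sum_pow_mul_eq_add_pow κ ((Q - 1) * z) 1
    _ = (z ^ (-τ) * ((Q - 1) * z + 1)) ^ Fintype.card κ := by
        rw [mul_pow, ← neg_mul, Real.rpow_mul z_pos.le, Real.rpow_natCast]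
    _ = (2 : ℝ) ^ (Fintype.card κ * entropy Q τ) := by
        rw [z_def, rpow_neg_mul_add_one_eq_two_rpow_entropy hQ ⟨hτ.1, hτ1⟩, mul_comm,
          Real.rpow_mul zero_le_two, Real.rpow_natCast]

end BallVolume

section Channel

variable {q n M : ℕ}

theorem W_nonneg (y x : ZMod q) : 0 ≤ W y x := by
  unfold W
  positivity

theorem Wn_nonneg (y x : Fin n → ZMod q) : 0 ≤ Wn y x :=
  Finset.prod_nonneg fun k _ => W_nonneg (y k) (x k)

theorem Code.dec_le_one (c : Code q n M) (y : Fin n → ZMod q) (m : Fin M) : c.dec y m ≤ 1 :=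
  c.dec_sum y ▸ Finset.single_le_sum (fun i _ => c.dec_nonneg y i) (Finset.mem_univ m)

theorem Code.dec_add_dec_le_one (c : Code q n M) (y : Fin n → ZMod q) {m m' : Fin M}
    (hm : m ≠ m') : c.dec y m + c.dec y m' ≤ 1 := by
  rw [← c.dec_sum y, ← Finset.sum_pair hm]
  exact Finset.sum_le_univ_sum_of_nonneg (c.dec_nonneg y)

theorem half_pow_le_sum_min [NeZero q] [Nontrivial (ZMod q)] {x x' : ZMod q}
    (h : Confusable x x') :
    (1 / 2 : ℝ) ^ (if x ≠ x' then 1 else 0) ≤ ∑ y, min (W y x) (W y x') := by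
  have term_nonneg (y : ZMod q) : 0 ≤ min (W y x) (W y x') := le_min (W_nonneg y x) (W_nonneg y x')
  rcases h with rfl | rfl | rfl
  · have sum_pair_le := Finset.sum_le_univ_sum_of_nonneg (s := {x, x + 1}) term_nonneg
    rw [Finset.sum_pair (by simp)] at sum_pair_le
    norm_num [W] at sum_pair_le ⊢
    exact sum_pair_le
  · refine le_trans (le_of_eq ?_)
      (Finset.single_le_sum (fun y _ => term_nonneg y) (Finset.mem_univ (x' + 1)))
    simp [W]
  · refine le_trans (le_of_eq ?_)
      (Finset.single_le_sum (fun y _ => term_nonneg y) (Finset.mem_univ (x + 1)))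
    simp [W]

theorem half_pow_hammingDist_le_sum_prod_min [NeZero q] [Nontrivial (ZMod q)]
    {x x' : Fin n → ZMod q} (h : ∀ k, Confusable (x k) (x' k)) :
    (1 / 2 : ℝ) ^ hammingDist x x'
      ≤ ∑ y : Fin n → ZMod q, ∏ k, min (W (y k) (x k)) (W (y k) (x' k)) :=
  calc (1 / 2 : ℝ) ^ hammingDist x x'
      = ∏ k, (1 / 2 : ℝ) ^ (if x k ≠ x' k then 1 else 0) := by
        rw [Finset.prod_pow_eq_pow_sum, hammingDist, Finset.card_filter]
    _ ≤ ∏ k, ∑ y, min (W y (x k)) (W y (x' k)) :=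
        Finset.prod_le_prod (fun k _ => by positivity) fun k _ => half_pow_le_sum_min (h k)
    _ = ∑ y : Fin n → ZMod q, ∏ k, min (W (y k) (x k)) (W (y k) (x' k)) := by
        rw [Finset.prod_univ_sum, Fintype.piFinset_univ]

theorem prod_min_le_min_Wn (y x x' : Fin n → ZMod q) :
    ∏ k, min (W (y k) (x k)) (W (y k) (x' k)) ≤ min (Wn y x) (Wn y x') :=
  le_min
    (Finset.prod_le_prod (fun _ _ => le_min (W_nonneg _ _) (W_nonneg _ _))
      fun _ _ => min_le_left _ _)
    (Finset.prod_le_prod (fun _ _ => le_min (W_nonneg _ _) (W_nonneg _ _))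
      fun _ _ => min_le_right _ _)

variable [NeZero q]

theorem Code.err_nonneg (c : Code q n M) (m : Fin M) : 0 ≤ c.err m :=
  Finset.sum_nonneg fun y _ => mul_nonneg (Wn_nonneg _ _) (sub_nonneg.mpr (c.dec_le_one y m))

theorem Code.sum_min_Wn_le_err_add_err (c : Code q n M) {m m' : Fin M} (hm : m ≠ m') :
    ∑ y, min (Wn y (c.enc m)) (Wn y (c.enc m')) ≤ c.err m + c.err m' := by
  rw [Code.err, Code.err, ← Finset.sum_add_distrib]
  refine Finset.sum_le_sum fun y _ => ?_
  set t := min (Wn y (c.enc m)) (Wn y (c.enc m'))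
  calc t ≤ t * ((1 - c.dec y m) + (1 - c.dec y m')) :=
        le_mul_of_one_le_right (le_min (Wn_nonneg _ _) (Wn_nonneg _ _))
          (by linarith [c.dec_add_dec_le_one y hm])
    _ ≤ Wn y (c.enc m) * (1 - c.dec y m) + Wn y (c.enc m') * (1 - c.dec y m') := by
        rw [mul_add]
        have dec_le := sub_nonneg.mpr (c.dec_le_one y m)
        have dec_le' := sub_nonneg.mpr (c.dec_le_one y m')
        gcongr
        exacts [min_le_left _ _, min_le_right _ _]

theorem Code.half_pow_hammingDist_le_err_add_err [Nontrivial (ZMod q)] (c : Code q n M)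
    {m m' : Fin M} (hm : m ≠ m') (h : ∀ k, Confusable (c.enc m k) (c.enc m' k)) :
    (1 / 2 : ℝ) ^ hammingDist (c.enc m) (c.enc m') ≤ c.err m + c.err m' :=
  calc (1 / 2 : ℝ) ^ hammingDist (c.enc m) (c.enc m')
      ≤ ∑ y : Fin n → ZMod q, ∏ k, min (W (y k) (c.enc m k)) (W (y k) (c.enc m' k)) :=
        half_pow_hammingDist_le_sum_prod_min h
    _ ≤ ∑ y, min (Wn y (c.enc m)) (Wn y (c.enc m')) :=
        Finset.sum_le_sum fun y _ => prod_min_le_min_Wn y _ _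
    _ ≤ c.err m + c.err m' := c.sum_min_Wn_le_err_add_err hm

theorem half_card_le_card_filter_le_two_mul_avg {ι : Type*} [Fintype ι] {f : ι → ℝ}
    (hf : ∀ i, 0 ≤ f i) :
    (Fintype.card ι : ℝ) / 2
      ≤ (Finset.univ.filter fun i => f i ≤ 2 * ((∑ i, f i) / Fintype.card ι)).card := by
  have card_add_card := Finset.card_filter_add_card_filter_not (s := Finset.univ)
    (fun i => f i ≤ 2 * ((∑ i, f i) / Fintype.card ι))
  set a := (∑ i, f i) / Fintype.card ι
  set B := Finset.univ.filter fun i => ¬f i ≤ 2 * a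
  by_contra! h_lt
  have card_lt : (Fintype.card ι : ℝ) / 2 < B.card := by
    rw [Finset.card_univ] at card_add_card
    rw [← card_add_card] at h_lt ⊢
    push_cast at h_lt ⊢
    linarith
  have B_nonempty : B.Nonempty := by
    rw [← Finset.card_pos, ← Nat.cast_pos (α := ℝ)]
    exact lt_of_le_of_lt (by positivity) card_lt
  have : Nonempty ι := ⟨B_nonempty.choose⟩
  have a_nonneg : 0 ≤ a := div_nonneg (Finset.sum_nonneg fun i _ => hf i) (Nat.cast_nonneg _)
  have sum_lt : ∑ i ∈ B, 2 * a < ∑ i ∈ B, f i :=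
    Finset.sum_lt_sum_of_nonempty B_nonempty fun i hi => by simpa [B] using hi
  have sum_le : ∑ i ∈ B, f i ≤ Fintype.card ι * a := by
    rw [mul_div_cancel₀ _ (by positivity)]
    exact Finset.sum_le_univ_sum_of_nonneg hf
  rw [Finset.sum_const, nsmul_eq_mul] at sum_lt
  nlinarith

theorem Code.rpow_div_four_le_avgErr [Nontrivial (ZMod q)] (c : Code q n M) {d : ℝ}
    (h : ∀ A : Finset (Fin M), (M : ℝ) / 2 ≤ A.card → ¬HasConfusableDist d fun m : A => c.enc m) :
    (2 : ℝ) ^ (-d) / 4 ≤ c.avgErr := by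
  have half_le := half_card_le_card_filter_le_two_mul_avg c.err_nonneg
  rw [Fintype.card_fin] at half_le
  have h_dist := h _ half_le
  simp only [HasConfusableDist, not_forall, not_le, Subtype.forall] at h_dist
  obtain ⟨m, hm, m', hm', hne, h_conf, h_lt⟩ := h_dist
  rw [Finset.mem_filter_univ] at hm hm'
  have rpow_le : (2 : ℝ) ^ (-d) ≤ (1 / 2 : ℝ) ^ hammingDist (c.enc m) (c.enc m') := by
    rw [one_div, inv_pow, ← Real.rpow_natCast, ← Real.rpow_neg zero_le_two]
    exact Real.rpow_le_rpow_of_exponent_le one_le_two (by linarith)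
  have := c.half_pow_hammingDist_le_err_add_err (fun h => hne (Subtype.ext h)) h_conf
  rw [Code.avgErr]
  linarith

theorem Code.avgErr_nonneg (c : Code q n M) : 0 ≤ c.avgErr :=
  div_nonneg (Finset.sum_nonneg fun m _ => c.err_nonneg m) M.cast_nonneg

theorem Code.avgErr_le_maxErr (c : Code q n M) : c.avgErr ≤ c.maxErr := by
  refine div_le_of_le_mul₀ M.cast_nonneg (Real.iSup_nonneg c.err_nonneg) ?_
  calc ∑ m, c.err m ≤ ∑ _m : Fin M, c.maxErr :=
        Finset.sum_le_sum fun m _ => le_ciSup (Set.finite_range c.err).bddAbove m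
    _ = c.maxErr * M := by simp [mul_comm]

instance [NeZero M] : Nonempty (Code q n M) :=
  ⟨{ enc := fun _ _ => 0
     dec := fun _ m => if m = 0 then 1 else 0
     dec_nonneg := fun _ m => by positivity
     dec_sum := fun _ => by simp }⟩

theorem PeAvg_le_PeMax (q M n : ℕ) [NeZero q] : PeAvg q M n ≤ PeMax q M n :=
  ciInf_mono ⟨0, by rintro - ⟨c, rfl⟩; exact c.avgErr_nonneg⟩ Code.avgErr_le_maxErr

end Channel

section ErrorExponent

theorem errExponent_anti {p p' : ℝ} {n : ℕ} (hp : 0 ≤ p) (h : p ≤ p') :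
    errExponent p' n ≤ errExponent p n := by
  unfold errExponent
  split_ifs with hp' hp0 hp0
  · exact le_rfl
  · exact absurd (le_antisymm (h.trans_eq hp') hp) hp0
  · exact le_top
  · have p_pos := hp.lt_of_ne' hp0
    have p'_pos := p_pos.trans_le h
    rw [EReal.coe_le_coe_iff]
    gcongr
    exact one_lt_two

theorem EMax_le_EAvg (q : ℕ) [NeZero q] (R : ℝ) : EMax q R ≤ EAvg q R :=
  limsup_le_limsup (Eventually.of_forall fun n => errExponent_anti
    (Real.iInf_nonneg Code.avgErr_nonneg) (PeAvg_le_PeMax q _ n))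

theorem errExponent_le_of_rpow_div_four_le {p δ : ℝ} {n : ℕ} (hn : 0 < n)
    (h : (2 : ℝ) ^ (-(δ * n)) / 4 ≤ p) : errExponent p n ≤ (δ + 2 / n : ℝ) := by
  have hp : 0 < p := lt_of_lt_of_le (by positivity) h
  have logb_le : Real.logb 2 (1 / p) ≤ δ * n + 2 := by
    rw [Real.logb_le_iff_le_rpow one_lt_two (by positivity), one_div,
      inv_le_comm₀ hp (by positivity)]
    refine le_trans (le_of_eq ?_) h
    rw [← Real.rpow_neg zero_le_two, neg_add, Real.rpow_add two_pos, div_eq_mul_inv]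
    norm_num
  rw [errExponent, if_neg hp.ne', EReal.coe_le_coe_iff]
  calc 1 / (n : ℝ) * Real.logb 2 (1 / p) ≤ 1 / (n : ℝ) * (δ * n + 2) := by gcongr
    _ = δ + 2 / n := by field_simp

theorem reliability_le {Pe : ℕ → ℕ → ℝ} {R E : ℝ}
    (h : ∀ δ, E < δ → ∀ᶠ n : ℕ in atTop,
      (2 : ℝ) ^ (-(δ * n)) / 4 ≤ Pe ⌈(2 : ℝ) ^ ((n : ℝ) * R)⌉₊ n) :
    reliability Pe R ≤ (E : EReal) := by
  refine EReal.le_of_forall_lt_iff_le.mp fun δ hδ => ?_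
  obtain ⟨δ', h_lower, h_upper⟩ := exists_between (EReal.coe_lt_coe_iff.mp hδ)
  have two_div_lt : ∀ᶠ n : ℕ in atTop, (2 : ℝ) / n < δ - δ' :=
    (tendsto_const_div_atTop_nhds_zero_nat (2 : ℝ)).eventually
      (gt_mem_nhds (sub_pos.mpr h_upper))
  refine limsup_le_of_le (by isBoundedDefault) ?_
  filter_upwards [h δ' h_lower, two_div_lt, eventually_gt_atTop 0] with n h_rpow h_div hn
  refine (errExponent_le_of_rpow_div_four_le hn h_rpow).trans (EReal.coe_le_coe_iff.mpr ?_)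
  linarith

end ErrorExponent

section Asymptotics

variable {C τ δ α : ℝ}

theorem one_add_mul_krawtchoukRoot (hC : 0 < C) (τ : ℝ) :
    (1 + C) * krawtchoukRoot (1 + 1 / C) τ = 1 - (2 * √(τ * (1 - τ) * C) + (1 - C) * τ) := by
  have sqrt_eq : √((1 + 1 / C - 1) * τ * (1 - τ)) = √(τ * (1 - τ) * C) / C := by
    have : (1 + 1 / C - 1) * τ * (1 - τ) = τ * (1 - τ) * C / C ^ 2 := by field_simp; ring
    rw [this, Real.sqrt_div' _ (sq_nonneg C), Real.sqrt_sq hC.le]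
  rw [krawtchoukRoot, sqrt_eq]
  field_simp
  ring

theorem tendsto_windowEigenvalue_div {a : ℕ → ℕ}
    (ha : Tendsto (fun n : ℕ => (a n : ℝ) / n) atTop (𝓝 τ)) (C : ℝ) (m : ℕ) :
    Tendsto (fun n : ℕ => windowEigenvalue C n (a n) m / n) atTop
      (𝓝 (2 * √(τ * (1 - τ) * C) * Real.cos (π / (m + 2)) + (1 - C) * τ)) := by
  have h_lim : Tendsto (fun n : ℕ => 2 * √((a n : ℝ) / n * (1 - a n / n - m / n) * C)
      * Real.cos (π / (m + 2)) + (1 - C) * (a n / n)) atTop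
      (𝓝 (2 * √(τ * (1 - τ - 0) * C) * Real.cos (π / (m + 2)) + (1 - C) * τ)) :=
    ((((ha.mul ((ha.const_sub 1).sub
      (tendsto_const_div_atTop_nhds_zero_nat (m : ℝ)))).mul_const C).sqrt.const_mul 2).mul_const
        _).add (ha.const_mul (1 - C))
  rw [sub_zero] at h_lim
  refine h_lim.congr' ?_
  filter_upwards [eventually_gt_atTop 0] with n hn
  have radicand_eq : (a n : ℝ) / n * (1 - a n / n - m / n) * C
      = a n * (n - a n - m) * C / n ^ 2 := by
    field_simp
  rw [windowEigenvalue, radicand_eq, Real.sqrt_div' _ (sq_nonneg _), Real.sqrt_sq n.cast_nonneg]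
  field_simp

theorem tendsto_floor_mul_sub_div (hτ : 0 ≤ τ) (m : ℕ) :
    Tendsto (fun n : ℕ => ((⌊τ * n⌋₊ - m : ℕ) : ℝ) / n) atTop (𝓝 τ) := by
  have floor_lim : Tendsto (fun n : ℕ => (⌊τ * n⌋₊ : ℝ) / n) atTop (𝓝 τ) :=
    (tendsto_nat_floor_mul_div_atTop hτ).comp tendsto_natCast_atTop_atTop
  have sub_lim := floor_lim.sub (tendsto_const_div_atTop_nhds_zero_nat (m : ℝ))
  rw [sub_zero] at sub_lim
  refine tendsto_of_tendsto_of_tendsto_of_le_of_le sub_lim floor_lim (fun n => ?_) fun n => ?_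
  · have : (⌊τ * n⌋₊ : ℝ) ≤ (⌊τ * n⌋₊ - m : ℕ) + m := by exact_mod_cast le_tsub_add
    rw [← sub_div]
    gcongr
    linarith
  · dsimp only
    gcongr
    exact tsub_le_self

theorem exists_lt_mul_cos_pi_div_add {β γ : ℝ} (h : α < β + γ) :
    ∃ m : ℕ, α < β * Real.cos (π / (m + 2)) + γ := by
  have cos_lim : Tendsto (fun m : ℕ => Real.cos (π / (m + 2))) atTop (𝓝 1) := by
    rw [← Real.cos_zero]
    refine (Real.continuous_cos.tendsto 0).comp (Tendsto.const_div_atTop ?_ _)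
    exact tendsto_atTop_add_const_right _ _ tendsto_natCast_atTop_atTop
  have h_lim := (cos_lim.const_mul β).add_const γ
  rw [mul_one] at h_lim
  exact (h_lim.eventually (lt_mem_nhds h)).exists

theorem eventually_exists_le_windowEigenvalue (hτ : 0 < τ)
    (h : α < 2 * √(τ * (1 - τ) * C) + (1 - C) * τ) :
    ∃ m : ℕ, ∃ η > 0, ∀ᶠ n : ℕ in atTop,
      ∃ a ≥ 1, (a + m : ℕ) ≤ τ * n ∧ (α + η) * n ≤ windowEigenvalue C n a m := by
  obtain ⟨m, hm⟩ := exists_lt_mul_cos_pi_div_add h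
  obtain ⟨α', h_lower, h_upper⟩ := exists_between hm
  have mul_lim : Tendsto (fun n : ℕ => τ * (n : ℝ)) atTop atTop :=
    tendsto_natCast_atTop_atTop.const_mul_atTop hτ
  refine ⟨m, α' - α, sub_pos.mpr h_lower, ?_⟩
  filter_upwards [eventually_gt_atTop 0,
    (tendsto_nat_floor_atTop.comp mul_lim).eventually_ge_atTop (m + 1),
    (tendsto_windowEigenvalue_div (tendsto_floor_mul_sub_div hτ.le m) C m).eventually
      (lt_mem_nhds h_upper)] with n hn h_floor h_eig
  refine ⟨⌊τ * n⌋₊ - m, Nat.le_sub_of_add_le' h_floor, ?_, ?_⟩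
  · rw [Nat.sub_add_cancel (by simp at h_floor; omega)]
    exact Nat.floor_le (by positivity)
  · rw [add_sub_cancel]
    exact ((lt_div_iff₀ (by positivity)).mp h_eig).le

theorem eventually_card_le_of_hasConfusableDist {q : ℕ} [NeZero q] [Nontrivial (ZMod q)]
    (hC : 0 < C) (hC1 : C ≤ 1) (hcos : ∀ ω : ZMod q, -C ≤ Real.cos (2 * π * ω.val / q))
    (hδ : 0 ≤ δ) (hτ : τ ∈ Ioo 0 (1 - 1 / (1 + 1 / C)))
    (h_root : krawtchoukRoot (1 + 1 / C) τ < δ) :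
    ∃ K : ℝ, ∀ᶠ n : ℕ in atTop, ∀ (ι : Type*) [Fintype ι] (c : ι → Fin n → ZMod q),
      HasConfusableDist (δ * n) c →
        Fintype.card ι ≤ K * (q * C / (1 + C) * 2 ^ entropy (1 + 1 / C) τ) ^ n := by
  have hQ : 1 < 1 + 1 / C := lt_add_of_pos_right 1 (by positivity)
  have lt_eig : 1 - (1 + C) * δ < 2 * √(τ * (1 - τ) * C) + (1 - C) * τ := by
    have := mul_lt_mul_of_pos_left h_root (show 0 < 1 + C by positivity)
    rw [one_add_mul_krawtchoukRoot hC] at this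
    linarith
  obtain ⟨m, η, hη, h_ev⟩ := eventually_exists_le_windowEigenvalue hτ.1 lt_eig
  refine ⟨(1 + C) * δ / η, ?_⟩
  filter_upwards [h_ev, eventually_gt_atTop 0] with n ⟨a, ha, h_floor, h_eig⟩ hn ι _ c hc
  have hn' : (0 : ℝ) < n := by exact_mod_cast hn
  have ham : a + m < Fintype.card (Fin n) := by
    rw [Fintype.card_fin, ← Nat.cast_lt (α := ℝ)]
    exact h_floor.trans_lt (mul_lt_of_lt_one_left hn' (hτ.2.trans (one_sub_inv_mem_Ioo hQ).2))
  have volume_le : ∑ S : Finset (Fin n) with S.card ≤ a + m, C⁻¹ ^ S.card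
      ≤ (2 : ℝ) ^ (n * entropy (1 + 1 / C) τ) := by
    simpa using sum_pow_card_le_two_rpow_entropy hQ hτ (κ := Fin n) (by simpa using h_floor)
  have lp_bound := card_mul_le_sum_inv_pow_card hC hC1 hcos (d := δ * n) (by positivity) hc ha ham
    (ε := η * n) (by positivity) (by rw [Fintype.card_fin]; linarith)
  rw [Fintype.card_fin] at lp_bound
  have card_mul_le : η * n * ((1 + C) / (C * q)) ^ n * Fintype.card ι
      ≤ (1 + C) * (δ * n) * (2 ^ entropy (1 + 1 / C) τ) ^ n := by
    rw [← Real.rpow_mul_natCast zero_le_two, mul_comm (entropy _ _)]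
    exact lp_bound.trans (by gcongr)
  have hq : (0 : ℝ) < q := Nat.cast_pos.mpr (NeZero.pos q)
  have rate_eq : q * C / (1 + C) = ((1 + C) / (C * q))⁻¹ := by rw [inv_div, mul_comm C]
  rw [rate_eq, mul_pow, inv_pow]
  refine le_of_mul_le_mul_left (card_mul_le.trans_eq ?_)
    (show 0 < η * n * ((1 + C) / (C * q)) ^ n by positivity)
  field_simp

end Asymptotics

section CycleParameters

variable {q : ℕ}

theorem one_lt_altSize (hq : 3 ≤ q) : 1 < altSize q :=
  lt_add_of_pos_right 1 (one_div_pos.mpr (cos_pi_div_natCast_pos hq))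

theorem two_rpow_lovaszRate (hq : 3 ≤ q) :
    (2 : ℝ) ^ lovaszRate q = q * Real.cos (π / q) / (1 + Real.cos (π / q)) := by
  have := cos_pi_div_natCast_pos hq
  rw [lovaszRate, Real.rpow_logb two_pos (by norm_num) (by positivity)]

theorem lovaszRate_add_logb_altSize (hq : 3 ≤ q) :
    lovaszRate q + Real.logb 2 (altSize q) = Real.logb 2 q := by
  have cos_pos := cos_pi_div_natCast_pos hq
  rw [lovaszRate, ← Real.logb_mul (by positivity) (zero_lt_one.trans (one_lt_altSize hq)).ne',
    altSize]
  congr 1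
  field_simp
  ring

theorem altSize_five : altSize 5 = √5 := by
  have sqrt_sq : √5 ^ 2 = (5 : ℝ) := Real.sq_sqrt (by norm_num)
  rw [altSize, Nat.cast_ofNat, Real.cos_pi_div_five]
  field_simp
  linarith

theorem lovaszRate_five : lovaszRate 5 = Real.logb 2 √5 := by
  have sqrt_sq : √5 ^ 2 = (5 : ℝ) := Real.sq_sqrt (by norm_num)
  rw [lovaszRate, Nat.cast_ofNat, Real.cos_pi_div_five]
  congr 1
  field_simp
  linarith

end CycleParameters

section Reliability

variable {q : ℕ} [NeZero q] {R δ : ℝ}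

theorem eventually_rpow_div_four_le_avgErr (hq : Odd q) (hq3 : 3 ≤ q)
    (hR : R ∈ Ioc (lovaszRate q) (Real.logb 2 q))
    (hδ : ELP1 (lovaszRate q) (altSize q) R < δ) :
    ∀ᶠ n : ℕ in atTop, ∀ c : Code q n ⌈(2 : ℝ) ^ ((n : ℝ) * R)⌉₊,
      (2 : ℝ) ^ (-(δ * n)) / 4 ≤ c.avgErr := by
  have hQ := one_lt_altSize hq3
  rw [← lovaszRate_add_logb_altSize hq3] at hR
  have : Fact (1 < q) := ⟨by omega⟩
  obtain ⟨τ, hτ, h_root, h_rate⟩ := exists_krawtchoukRoot_lt hQ hR hδ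
  have δ_nonneg := ((ELP1_mem hQ (Ioc_subset_Icc_self hR)).1.trans_lt hδ).le
  obtain ⟨K, hK⟩ := eventually_card_le_of_hasConfusableDist (cos_pi_div_natCast_pos hq3)
    (Real.cos_le_one _) (fun ω : ZMod q => neg_cos_pi_div_le_cos hq ω.val_lt.le) δ_nonneg hτ h_root
  have rpow_lim : Tendsto (fun n : ℕ => (2 : ℝ) ^ ((n : ℝ) *
      (R - (lovaszRate q + entropy (altSize q) τ)))) atTop atTop :=
    (tendsto_rpow_atTop_of_base_gt_one 2 one_lt_two).comp
      (tendsto_natCast_atTop_atTop.atTop_mul_const (sub_pos.mpr h_rate))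
  filter_upwards [hK, rpow_lim.eventually_gt_atTop (2 * K)] with n h_card h_lt c
  refine c.rpow_div_four_le_avgErr fun A hA h_dist => ?_
  have card_le := h_card A (fun m => c.enc m) h_dist
  rw [← two_rpow_lovaszRate hq3, ← Real.rpow_add two_pos, ← Real.rpow_mul_natCast zero_le_two,
    Fintype.card_coe, mul_comm _ (n : ℝ)] at card_le
  rw [mul_sub, Real.rpow_sub two_pos, lt_div_iff₀ (by positivity)] at h_lt
  have : (2 : ℝ) ^ ((n : ℝ) * R) ≤ ⌈(2 : ℝ) ^ ((n : ℝ) * R)⌉₊ := Nat.le_ceil _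
  rw [altSize] at h_lt
  linarith

theorem EAvg_le_ELP1 (hq : Odd q) (hq3 : 3 ≤ q) (hR : R ∈ Ioc (lovaszRate q) (Real.logb 2 q)) :
    EAvg q R ≤ ELP1 (lovaszRate q) (altSize q) R := by
  refine reliability_le fun δ hδ => ?_
  filter_upwards [eventually_rpow_div_four_le_avgErr hq hq3 hR hδ] with n h_le
  have : NeZero ⌈(2 : ℝ) ^ ((n : ℝ) * R)⌉₊ := ⟨(Nat.ceil_pos.mpr (by positivity)).ne'⟩
  exact le_ciInf h_le

end Reliability

end Typewriter

open Typewriter in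
theorem theorem2_general (q : ℕ) [NeZero q] (hq : Odd q) (hq3 : 3 ≤ q) :
    BijOn (rateLP1 (lovaszRate q) (altSize q)) (Icc 0 (1 - 1 / altSize q))
        (Icc (lovaszRate q) (Real.logb 2 q)) ∧
      ∀ R : ℝ, lovaszRate q < R → R ≤ Real.logb 2 q →
        EAvg q R ≤ ELP1 (lovaszRate q) (altSize q) R ∧
        EMax q R ≤ ELP1 (lovaszRate q) (altSize q) R :=
  ⟨lovaszRate_add_logb_altSize hq3 ▸ rateLP1_bijOn (one_lt_altSize hq3) (lovaszRate q),
    fun R hR hR' =>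
      have h_avg := EAvg_le_ELP1 hq hq3 ⟨hR, hR'⟩
      ⟨h_avg, (EMax_le_EAvg q R).trans h_avg⟩⟩

theorem theorem2 :
    -- the channel with five inputs: the inverse function is well defined, and the bound holds
    (BijOn (Typewriter.rateLP1 (Real.logb 2 √5) √5) (Icc 0 (1 - 1 / √5))
        (Icc (Real.logb 2 √5) (Real.logb 2 5)) ∧
      ∀ R : ℝ, Real.logb 2 √5 < R → R < Real.logb 2 (5 / 2) →
        Typewriter.EAvg 5 R ≤ (Typewriter.ELP1 (Real.logb 2 √5) √5 R : EReal) ∧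
        Typewriter.EMax 5 R ≤ (Typewriter.ELP1 (Real.logb 2 √5) √5 R : EReal)) ∧
    -- the extension to any odd number of inputs
    (∀ (q : ℕ) [NeZero q], Odd q → 3 ≤ q →
      BijOn (Typewriter.rateLP1 (Typewriter.lovaszRate q) (Typewriter.altSize q))
        (Icc 0 (1 - 1 / Typewriter.altSize q))
        (Icc (Typewriter.lovaszRate q) (Real.logb 2 q)) ∧
      ∀ R : ℝ, Typewriter.lovaszRate q < R → R < Real.logb 2 ((q : ℝ) / 2) →
        Typewriter.EAvg q R ≤
          (Typewriter.ELP1 (Typewriter.lovaszRate q) (Typewriter.altSize q) R : EReal) ∧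
        Typewriter.EMax q R ≤
          (Typewriter.ELP1 (Typewriter.lovaszRate q) (Typewriter.altSize q) R : EReal)) := by
  have h (q : ℕ) [NeZero q] (hq : Odd q) (hq3 : 3 ≤ q) :=
    (theorem2_general q hq hq3).imp_right fun h_le R hR (hR' : R < Real.logb 2 ((q : ℝ) / 2)) =>
      h_le R hR (hR'.le.trans (Real.logb_le_logb_of_le one_lt_two
        (half_pos (Nat.cast_pos.mpr (NeZero.pos q))) (half_le_self q.cast_nonneg)))
  refine ⟨?_, h⟩
  simpa only [Typewriter.altSize_five, Typewriter.lovaszRate_five, Nat.cast_ofNat] using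
    h 5 (by decide) (by norm_num)
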